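/- **Setting.** Let $s=n^2$ be a perfect square and consider a generalized Sudoku puzzle: a partially filled $s\times s$ grid, to be completed so that each row, each column and each of the $s$ sub-grids of size $n\times n$ contains all digits $1,\dots,s$. In the lifted formulation the unknown is $x\in\mathbb R^{s\times s\times s}$ (with the Euclidean norm), where $x(i,j,\cdot)$ encodes the digit in cell $(i,j)$, and with $e=(1,0,\dots,0)$ the constraint sets are: $C_1$: every row $x(:,j,k)$ is a permutation of $e$; $C_2$: every column $x(i,:,k)$ is a permutation of $e$; $C_3$: every pillar $x(i,j,:)$ is a permutation of $e$; $C_4$: for every $k$, each of the $s$ sub-grids of size $n\times n$ of $x(:,:,k)$ is a permutation of $e$; $C_5$: the affine subspace of all $x$ such that $x(i,j,:)$ is the $d$-th unit vector whenever the digit $d$ is provided in cell $(i,j)$. Put $\mathcal H=(\mathbb R^{s\times s\times s})^5$ with $\|\boldsymbol x\|^2=\sum_i\|x_i\|^2$, $\mathcal C=C_1\times\dots\times C_5$ and $\mathcal S=\{\boldsymbol x\in\mathcal H: x_1=\dots=x_5\}$. For a non-empty closed set $C$ let $P_C(x)=\{y\in C:\|x-y\|=\mathrm{dist}(x,C)\}$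 and $P_C^{\lambda}=\lambda P_C+(1-\lambda)\mathrm{Id}$. The limiting normal cone $N_C(x)$ is the set of limits of vectors $v_k$ such that $v_k=t_k(w_k-x_k)$ with $t_k\ge 0$, $x_k\in P_C(w_k)$ and $x_k\to x$. A point $x\in C$ is stationary for $\min\{f(x): x\in C\}$ if $f$ is differentiable at $x$ and $0\in\nabla f(x)+N_C(x)$. The damped Douglas–Rachford method with parameter $\gamma>0$, started at an arbitrary $\boldsymbol z_0\in\mathcal H$, is, for $k\ge 0$ and $i=1,\dots,5$, $$x_{i,k+1}=\tfrac1{1+\gamma}\Big(z_{i,k}+\gamma\,\tfrac15\sum_{j=1}^5 z_{j,k}\Big),\qquad u_{i,k+1}\in P_{C_i}(2x_{i,k+1}-z_{i,k}),\qquad z_{i,k+1}=z_{i,k}+u_{i,k+1}-x_{i,k+1},$$ and its set-valued fixed-point operator is $\mathcal F_\gamma=\frac12\big((2P_{\mathcal C}-\mathrm{Id})(2P_{\mathcal S}^{\gamma/(1+\gamma)}-\mathrm{Id})+\mathrm{Id}\big)$. **Proposition.** Suppose $\mathcal C\cap\mathcal S\neq\emptyset$ (the puzzle has a solution) and $0<\gamma<\sqrt{3/2}-1$.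 Then every sequence $(\boldsymbol u_k,\boldsymbol x_k,\boldsymbol z_k)$ generated by the method converges to some $(\boldsymbol x^\star,\boldsymbol x^\star,\boldsymbol z^\star)$, where $\boldsymbol z^\star\in\mathcal F_\gamma(\boldsymbol z^\star)$ is a fixed point and $\boldsymbol x^\star=P_{\mathcal S}^{\gamma/(1+\gamma)}(\boldsymbol z^\star)$ is a stationary point of $\min_{\boldsymbol x}\{\mathrm{dist}^2(\boldsymbol x,\mathcal S): \boldsymbol x\in\mathcal C\}$. If, moreover, the non-degeneracy condition $x_i^\star-z_i^\star\in\mathrm{int}\big(N_{C_i}(x_i^\star)\big)$ holds for $i=1,\dots,4$, then: - for all $k$ large enough, $u_{i,k}=x_i^\star$ for $i=1,\dots,4$; - $\|\boldsymbol z_k-\boldsymbol z^\star\|=O(\eta^k)$ with $\eta=\dfrac{2\gamma+5+\sqrt{25-16\gamma^2}}{10(1+\gamma)}$; - for all $k$ large enough, $\boldsymbol z_{k+1}-\boldsymbol z^\star=M_\gamma(\boldsymbol z_k-\boldsymbol z^\star)$ with the iteration matrix $M_\gamma=\frac1{1+\gamma}\big(\gamma(\mathrm{Id}+2\Pi_{\mathcal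 C}P_{\mathcal S}-\Pi_{\mathcal C}-P_{\mathcal S})+\Pi_{\mathcal C}\big)$, where $P_{\mathcal S}=\frac15\mathbf 1_{5\times5}\otimes\mathrm{Id}$ and $\Pi_{\mathcal C}=\mathrm{diag}(0,0,0,0,\Pi_5)$, with $\Pi_5$ the orthogonal projection onto the linear subspace parallel to $C_5$. Finally, if at least one cell of the given grid is blank, then $\eta$ is a semi-simple eigenvalue of $M_\gamma$, that is, an eigenvalue with $\mathrm{rank}(M_\gamma-\eta\,\mathrm{Id})=\mathrm{rank}\big((M_\gamma-\eta\,\mathrm{Id})^2\big)$. -/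

import Mathlib

noncomputable section

namespace DampedDR

/-! ### Projections, normal cones, stationarity -/

section General

variable {E : Type*} [NormedAddCommGroup E]

/-- The (set-valued) projection of `x` onto `C`. -/
def proj (C : Set E) (x : E) : Set E :=
  {y | y ∈ C ∧ ‖x - y‖ = Metric.infDist x C}

variable [InnerProductSpace ℝ E]

/-- The relaxed projection `P_C^l = l P_C + (1 - l) Id` (set-valued). -/
def relaxedProj (l : ℝ) (C : Set E) (x : E) : Set E :=
  {w | ∃ y ∈ proj C x, w = l • y + (1 - l) • x}

/-- The proximal normal cone `cone (P_C⁻¹(x) - x)` of `C` at `x`. -/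
def proximalNormalCone (C : Set E) (x : E) : Set E :=
  {v | ∃ t : ℝ, 0 ≤ t ∧ ∃ w : E, x ∈ proj C w ∧ v = t • (w - x)}

/-- The limiting normal cone of `C` at `x`: limits of proximal normals at points of `C`
converging to `x`. -/
def limitingNormalCone (C : Set E) (x : E) : Set E :=
  {v | ∃ (xs vs : ℕ → E), (∀ k, xs k ∈ C ∧ vs k ∈ proximalNormalCone C (xs k)) ∧
    Filter.Tendsto xs Filter.atTop (nhds x) ∧ Filter.Tendsto vs Filter.atTop (nhds v)}

/-- `x` is a stationary point of `min f` subject to `x ∈ C`: `f` is differentiable at `x ∈ C`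
and `0 ∈ ∇f(x) + N_C(x)`. -/
def IsStationaryPoint [CompleteSpace E] (f : E → ℝ) (C : Set E) (x : E) : Prop :=
  x ∈ C ∧ ∃ g : E, HasGradientAt f g x ∧ -g ∈ limitingNormalCone C x

/-- The set-valued fixed-point operator of the damped Douglas–Rachford method,
`½ ((2 P_C - Id)(2 P_S^{γ/(1+γ)} - Id) + Id)`. -/
def ddrOperator (γ : ℝ) (C S : Set E) (z : E) : Set E :=
  {w | ∃ x ∈ relaxedProj (γ / (1 + γ)) S z, ∃ u ∈ proj C ((2 : ℝ) • x - z),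
    w = (1 / 2 : ℝ) • (((2 : ℝ) • u - ((2 : ℝ) • x - z)) + z)}

end General

/-! ### The product space and the iteration -/

section Product

variable {m : ℕ} {E : Type*}

/-- The product `C₁ × ⋯ × C_m` in `E^m` (with the `ℓ²` product norm). -/
def prodSet (C : Fin m → Set E) : Set (PiLp 2 fun _ : Fin m => E) :=
  {x | ∀ i, x i ∈ C i}

/-- The diagonal subspace `{x : x₁ = ⋯ = x_m}` of `E^m`. -/
def diagonalSet (m : ℕ) (E : Type*) : Set (PiLp 2 fun _ : Fin m => E) :=
  {x | ∀ i j, x i = x j}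

/-- `(u_k, x_k, z_k)` is generated by the damped Douglas–Rachford method with parameter `γ` for
the sets `C₁, …, C_m`. The starting point `z 0` is arbitrary; `x 0` and `u 0` play no role. -/
def IsDDRSequence [NormedAddCommGroup E] [InnerProductSpace ℝ E] (γ : ℝ) (C : Fin m → Set E)
    (u x z : ℕ → PiLp 2 fun _ : Fin m => E) : Prop :=
  ∀ k i,
    x (k + 1) i = (1 / (1 + γ)) • (z k i + γ • ((1 / (m : ℝ)) • ∑ j, z k j)) ∧
    u (k + 1) i ∈ proj (C i) ((2 : ℝ) • x (k + 1) i - z k i) ∧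
    z (k + 1) i = z k i + u (k + 1) i - x (k + 1) i

end Product

/-- `η` is a semi-simple eigenvalue of `M`: an eigenvalue with
`rank (M - η Id) = rank ((M - η Id)²)`. -/
def IsSemisimpleEigenvalue {ι : Type*} [Fintype ι] [DecidableEq ι] (M : Matrix ι ι ℝ) (η : ℝ) :
    Prop :=
  Module.End.HasEigenvalue (Matrix.toLin' M) η ∧
    (M - η • (1 : Matrix ι ι ℝ)).rank = ((M - η • (1 : Matrix ι ι ℝ)) ^ 2).rank

/-! ### The lifted Sudoku problem on an `s × s` grid, `s = n²` -/

/-- Positions `(i, j, k)` of the `s × s × s` cube, `s = n²`. Here `(i, j)` is a cell of the grid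
and `k` a digit. -/
abbrev Pos (n : ℕ) : Type := Fin (n ^ 2) × Fin (n ^ 2) × Fin (n ^ 2)

/-- `ℝ^{s × s × s}` with its Euclidean structure. -/
abbrev Cube (n : ℕ) : Type := EuclideanSpace ℝ (Pos n)

/-- The five-fold product of `ℝ^{s × s × s}`. -/
abbrev Cube5 (n : ℕ) : Type := PiLp 2 fun _ : Fin 5 => Cube n

/-- The entries of `x` at the positions in `L` are a permutation of `(1, 0, …, 0)`. -/
def IsUnitOn {n : ℕ} (x : Cube n) (L : Set (Pos n)) : Prop :=
  ∃ p ∈ L, x p = 1 ∧ ∀ q ∈ L, q ≠ p → x q = 0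

/-- Each row `(:, j, k)` is a permutation of `(1, 0, …, 0)`. -/
def C₁ (n : ℕ) : Set (Cube n) :=
  {x | ∀ j k, IsUnitOn x {p | p.2.1 = j ∧ p.2.2 = k}}

/-- Each column `(i, :, k)` is a permutation of `(1, 0, …, 0)`. -/
def C₂ (n : ℕ) : Set (Cube n) :=
  {x | ∀ i k, IsUnitOn x {p | p.1 = i ∧ p.2.2 = k}}

/-- Each pillar `(i, j, :)` is a permutation of `(1, 0, …, 0)`. -/
def C₃ (n : ℕ) : Set (Cube n) :=
  {x | ∀ i j, IsUnitOn x {p | p.1 = i ∧ p.2.1 = j}}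

/-- For each digit `k`, each of the `s` sub-grids of size `n × n` is a permutation of
`(1, 0, …, 0)`. With indices from `0`, the sub-grid `(a, b)` consists of the cells `(i, j)` with
`n a ≤ i < n (a + 1)` and `n b ≤ j < n (b + 1)`. -/
def C₄ (n : ℕ) : Set (Cube n) :=
  {x | ∀ (a b : Fin n) (k : Fin (n ^ 2)),
    IsUnitOn x {p | (p.1 : ℕ) / n = a ∧ (p.2.1 : ℕ) / n = b ∧ p.2.2 = k}}

/-- A partially completed grid: `given i j = some d` if the digit `d` is provided in the cell
`(i, j)`, and `given i j = none` if the cell is blank. -/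
abbrev Grid (n : ℕ) : Type := Fin (n ^ 2) → Fin (n ^ 2) → Option (Fin (n ^ 2))

/-- The constraint of the provided numbers: the pillar over a cell with the provided digit `d` is
the `d`-th unit vector. -/
def C₅ {n : ℕ} (given : Grid n) : Set (Cube n) :=
  {x | ∀ i j d, given i j = some d → ∀ k, x (i, j, k) = if k = d then 1 else 0}

/-- The five constraint sets, indexed from `0`. -/
def sudokuSets {n : ℕ} (given : Grid n) : Fin 5 → Set (Cube n) :=
  ![C₁ n, C₂ n, C₃ n, C₄ n, C₅ given]

/-! ### The iteration matrix -/

/-- The vector of all coordinates of an element of the product space. -/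
def flat {n : ℕ} (z : Cube5 n) : Fin 5 × Pos n → ℝ := fun p => z p.1 p.2

/-- The matrix `(1/5) 1_{5×5} ⊗ Id` of the projection onto the diagonal. -/
def matS (n : ℕ) : Matrix (Fin 5 × Pos n) (Fin 5 × Pos n) ℝ :=
  Matrix.kroneckerMap (· * ·) ((1 / 5 : ℝ) • Matrix.of fun _ _ : Fin 5 => (1 : ℝ))
    (1 : Matrix (Pos n) (Pos n) ℝ)

/-- The matrix `diag(0, 0, 0, 0, P)`, where `P` is the linear part of the projection onto the
affine subspace `C₅`: it keeps the coordinates over blank cells and annihilates the others. -/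
def matC {n : ℕ} (given : Grid n) : Matrix (Fin 5 × Pos n) (Fin 5 × Pos n) ℝ :=
  Matrix.diagonal fun p => if p.1 = 4 ∧ given p.2.1 p.2.2.1 = none then 1 else 0

/-- The matrix `M_γ = (1/(1+γ)) (γ (Id + 2 P_C P_S - P_C - P_S) + P_C)`. -/
def iterationMatrix {n : ℕ} (γ : ℝ) (given : Grid n) :
    Matrix (Fin 5 × Pos n) (Fin 5 × Pos n) ℝ :=
  (1 / (1 + γ)) • (γ • (1 + (2 : ℝ) • (matC given * matS n) - matC given - matS n) + matC given)

/-- `η = (2γ + 5 + √(25 - 16γ²)) / (10 (1 + γ))`. -/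
def rate (γ : ℝ) : ℝ := (2 * γ + 5 + Real.sqrt (25 - 16 * γ ^ 2)) / (10 * (1 + γ))

end DampedDR

end

/-! With `Q` the projection onto the orthogonal complement of the diagonal, the shadow point
satisfies `z = x + γ Q x`, so the method is Douglas–Rachford splitting for `½ dist²` over the
product set. Its envelope is bounded below and drops at each step by at least `‖x_{k+1} - x_k‖² /
(2γ)` (`tendsto_shadow_sub_zero`); hence successive differences of `x`, `z` and `u` tend to zero.
Points of the first four sets have entries 0 or 1, so distinct ones lie at distance at least 1, and
these components of `u` are eventually constant (`IsDDRSequence.exists_forall_eq`).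

From then on the iteration is affine, and differences of iterates evolve by the iteration matrix
(`IsDDRSequence.flat_sub_eq`). The matrix splits into 5 × 5 blocks, one per position, whose modes
are explicit; every orbit is `O(η^k)` (`isBigO_orbit`). Applied to consecutive differences, this
makes `z` Cauchy with the stated rate. Passing to the limit in the projection steps gives the fixed
point and stationarity. The orbit bound also excludes Jordan blocks at `η`, since these would
produce growth `k η^k`. -/

namespace DampedDR

/-! ### Set-valued projections -/

section Projection

variable {E : Type*} [NormedAddCommGroup E]

theorem mem_proj_iff {C : Set E} {x y : E} :
    y ∈ proj C x ↔ y ∈ C ∧ ∀ y' ∈ C, ‖x - y‖ ≤ ‖x - y'‖ := by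
  refine and_congr_right fun hy => ⟨fun h y' hy' => ?_, fun h => le_antisymm ?_ ?_⟩
  · rw [h, ← dist_eq_norm]
    exact Metric.infDist_le_dist_of_mem hy'
  · exact (Metric.le_infDist ⟨y, hy⟩).2 fun y' hy' => by rw [dist_eq_norm]; exact h y' hy'
  · rw [← dist_eq_norm]
    exact Metric.infDist_le_dist_of_mem hy

/-- The graph of the projection is closed, up to membership of the limit in the set. -/
theorem mem_proj_of_tendsto {C : Set E} {w u : ℕ → E} {w' u' : E} (hu' : u' ∈ C)
    (hw : Filter.Tendsto w Filter.atTop (nhds w')) (hu : Filter.Tendsto u Filter.atTop (nhds u'))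
    (h : ∀ k, u k ∈ proj C (w k)) : u' ∈ proj C w' :=
  mem_proj_iff.2 ⟨hu', fun y' hy' =>
    le_of_tendsto_of_tendsto' (hw.sub hu).norm (hw.sub tendsto_const_nhds).norm
      fun k => (mem_proj_iff.1 (h k)).2 y' hy'⟩

theorem mem_proj_prodSet {m : ℕ} {C : Fin m → Set E} {u w : PiLp 2 fun _ : Fin m => E}
    (h : ∀ i, u i ∈ proj (C i) (w i)) : u ∈ proj (prodSet C) w := by
  refine mem_proj_iff.2 ⟨fun i => (h i).1, fun y hy => ?_⟩
  rw [← sq_le_sq₀ (norm_nonneg _) (norm_nonneg _), PiLp.norm_sq_eq_of_L2, PiLp.norm_sq_eq_of_L2]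
  refine Finset.sum_le_sum fun i _ => ?_
  gcongr
  exact (mem_proj_iff.1 (h i)).2 (y i) (hy i)

end Projection

/-! ### Squared distance to a subspace and the envelope -/

section Subspace

variable {H : Type*} [NormedAddCommGroup H] [InnerProductSpace ℝ H]
  (K : Submodule ℝ H) [K.HasOrthogonalProjection]

theorem starProjection_mem_proj (x : H) : K.starProjection x ∈ proj (K : Set H) x := by
  refine mem_proj_iff.2 ⟨K.starProjection_apply_mem x, fun y hy => ?_⟩
  rw [K.starProjection_minimal x]
  exact ciInf_le ⟨0, by rintro _ ⟨_, rfl⟩; positivity⟩ (⟨y, hy⟩ : K)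

theorem infDist_submodule (x : H) :
    Metric.infDist x (K : Set H) = ‖Kᗮ.starProjection x‖ := by
  rw [← (starProjection_mem_proj K x).2, Submodule.starProjection_orthogonal_val]

theorem inner_orthogonal_starProjection (x y : H) :
    inner ℝ (Kᗮ.starProjection x) y =
      inner ℝ (Kᗮ.starProjection x) (Kᗮ.starProjection y) := by
  rw [Submodule.inner_starProjection_left_eq_right, Submodule.inner_starProjection_left_eq_right,
    Submodule.starProjection_eq_self_iff.2 (Submodule.starProjection_apply_mem _ _)]

theorem hasGradientAt_infDist_submodule_sq [CompleteSpace H] (x : H) :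
    HasGradientAt (fun y => Metric.infDist y (K : Set H) ^ 2)
      ((2 : ℝ) • Kᗮ.starProjection x) x := by
  simp only [infDist_submodule]
  rw [hasGradientAt_iff_hasFDerivAt]
  have h := (Kᗮ.starProjection.hasFDerivAt (x := x)).norm_sq
  refine h.congr_fderiv ?_
  ext y
  simpa [real_inner_smul_left, -Submodule.starProjection_orthogonal_val] using
    (inner_orthogonal_starProjection K x y).symm

/-- The Douglas–Rachford envelope of half the squared distance to a subspace decreases along the
iteration, so consecutive shadow iterates get arbitrarily close. -/
theorem tendsto_shadow_sub_zero {C : Set H} {γ : ℝ} (hγ0 : 0 < γ) (hγ : γ ≤ 1 / 2)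
    {u x z : ℕ → H} (hx : ∀ k, z k = x k + γ • Kᗮ.starProjection (x k))
    (hu : ∀ k, u k ∈ proj C ((2 : ℝ) • x k - z k))
    (hz : ∀ k, z (k + 1) = z k + u k - x k) :
    Filter.Tendsto (fun k => x (k + 1) - x k) Filter.atTop (nhds 0) := by
  set Q := Kᗮ.starProjection with hQ
  set V : ℕ → ℝ := fun k => ‖Q (x k)‖ ^ 2 / 2 + inner ℝ (Q (x k)) (u k - x k) +
    ‖u k - x k‖ ^ 2 / (2 * γ) with hV
  have hdec : ∀ k, ‖x (k + 1) - x k‖ ^ 2 / (2 * γ) ≤ V k - V (k + 1) := by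
    intro k
    obtain ⟨d, hd⟩ : ∃ d, x (k + 1) = x k + d := ⟨x (k + 1) - x k, by abel⟩
    have hb : u k - x k = d + γ • Q d := by
      have := hz k
      rw [hx (k + 1), hx k, hd, map_add] at this
      rw [smul_add] at this
      rw [← sub_eq_zero] at this ⊢
      rw [← neg_eq_zero, ← this]
      abel
    obtain ⟨b, hb'⟩ : ∃ b, u (k + 1) - x (k + 1) = b := ⟨_, rfl⟩
    -- The previous point `u k` serves as competitor for the projection defining `u (k + 1)`.
    have hmin := (mem_proj_iff.1 (hu (k + 1))).2 (u k) (hu k).1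
    have e1 : (2 : ℝ) • x (k + 1) - z (k + 1) - u (k + 1) = -(b + γ • (Q (x k) + Q d)) := by
      rw [hx (k + 1), ← hb', hd, map_add, two_smul]; abel
    have e2 : (2 : ℝ) • x (k + 1) - z (k + 1) - u k = -(γ • Q d + γ • (Q (x k) + Q d)) := by
      have h3 : u k = x k + d + γ • Q d := by rw [add_assoc, ← hb]; abel
      rw [hx (k + 1), h3, hd, map_add, two_smul]; abel
    rw [e1, e2, norm_neg, norm_neg, ← sq_le_sq₀ (norm_nonneg _) (norm_nonneg _)] at hmin
    have hqd := inner_orthogonal_starProjection K (x k) d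
    have hdd := inner_orthogonal_starProjection K d d
    rw [← hQ] at hqd hdd
    have hnd : ‖Q d‖ ^ 2 ≥ 0 := by positivity
    have hVk : V k = ‖Q (x k)‖ ^ 2 / 2 + inner ℝ (Q (x k)) (d + γ • Q d) +
        ‖d + γ • Q d‖ ^ 2 / (2 * γ) := by simp only [hV, hb]
    have hVk1 : V (k + 1) = ‖Q (x k) + Q d‖ ^ 2 / 2 + inner ℝ (Q (x k) + Q d) b +
        ‖b‖ ^ 2 / (2 * γ) := by simp only [hV, hb']; rw [hd, map_add]
    rw [hVk, hVk1, hd, add_sub_cancel_left]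
    generalize Q (x k) = q at *
    generalize Q d = e at *
    simp only [← real_inner_self_eq_norm_sq, inner_add_left, inner_add_right,
      real_inner_smul_left, real_inner_smul_right] at *
    rw [real_inner_comm e q, real_inner_comm e d] at *
    rw [real_inner_comm q b, real_inner_comm e b] at hmin
    rw [hqd, hdd]
    -- Optimality divided by `2γ`, plus `(1/2 - γ)‖Q d‖²`, is exactly the slack in the claimed
    -- decrease.
    have key := add_nonneg (div_nonneg (sub_nonneg.2 hmin) (by positivity : 0 ≤ 2 * γ))
      (mul_nonneg (sub_nonneg.2 hγ) hnd)
    rw [← sub_nonneg]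
    refine key.trans_eq ?_
    field_simp
    ring
  -- Since `γ ≤ 1`, completing the square gives `V k ≥ ½ ‖Q (u k)‖²`.
  have hnonneg : ∀ k, 0 ≤ V k := by
    intro k
    have h1 := inner_orthogonal_starProjection K (x k) (u k - x k)
    rw [← hQ] at h1
    have h2 : ‖Q (u k - x k)‖ ≤ ‖u k - x k‖ := Submodule.norm_starProjection_apply_le _ _
    have h3 : ‖Q (x k) + Q (u k - x k)‖ ^ 2 = ‖Q (x k)‖ ^ 2 +
      2 * inner ℝ (Q (x k)) (Q (u k - x k)) + ‖Q (u k - x k)‖ ^ 2 := norm_add_sq_real _ _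
    have h4 : ‖u k - x k‖ ^ 2 / 2 ≤ ‖u k - x k‖ ^ 2 / (2 * γ) := by
      gcongr; linarith
    have h5 : ‖Q (u k - x k)‖ ^ 2 ≤ ‖u k - x k‖ ^ 2 := by gcongr
    simp only [hV]
    rw [h1]
    nlinarith [sq_nonneg ‖Q (x k) + Q (u k - x k)‖]
  have hanti : Antitone V := antitone_nat_of_succ_le fun k => by
    have := hdec k
    have h : 0 ≤ ‖x (k + 1) - x k‖ ^ 2 / (2 * γ) := by positivity
    linarith
  have hlim := tendsto_atTop_ciInf hanti ⟨0, by rintro _ ⟨k, rfl⟩; exact hnonneg k⟩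
  have h0 := hlim.sub (hlim.comp (Filter.tendsto_add_atTop_nat 1))
  rw [sub_self] at h0
  have h1 := squeeze_zero (fun k => by positivity) hdec h0
  rw [tendsto_zero_iff_norm_tendsto_zero]
  have h2 : Filter.Tendsto (fun k => Real.sqrt (2 * γ * (‖x (k + 1) - x k‖ ^ 2 / (2 * γ))))
      Filter.atTop (nhds (Real.sqrt (2 * γ * 0))) := (h1.const_mul _).sqrt
  rw [mul_zero, Real.sqrt_zero] at h2
  refine h2.congr fun k => ?_
  rw [mul_div_cancel₀ _ (by positivity), Real.sqrt_sq (norm_nonneg _)]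

end Subspace

/-! ### Coordinate form of the iteration matrix -/

section Matrix

variable {n : ℕ}

theorem iterationMatrix_mulVec_apply (γ : ℝ) (given : Grid n) (v : Fin 5 × Pos n → ℝ) (i : Fin 5)
    (p : Pos n) :
    (iterationMatrix γ given).mulVec v (i, p) =
      (1 / (1 + γ)) * if i = 4 ∧ given p.1 p.2.1 = none then
        γ * ((1 / 5) * ∑ j, v (j, p)) + v (i, p)
      else γ * (v (i, p) - (1 / 5) * ∑ j, v (j, p)) := by
  have hS : (matS n).mulVec v (i, p) = (1 / 5) * ∑ j, v (j, p) := by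
    simp only [Matrix.mulVec, dotProduct, matS, Matrix.kroneckerMap_apply, Matrix.smul_apply,
      Matrix.of_apply, smul_eq_mul, mul_one, Fintype.sum_prod_type (α₁ := Fin 5),
      Matrix.one_apply, mul_ite, mul_zero, ite_mul, zero_mul, Finset.sum_ite_eq,
      Finset.mem_univ, if_true, Finset.mul_sum]
  simp only [iterationMatrix, Matrix.smul_mulVec, Matrix.add_mulVec, Matrix.sub_mulVec,
    Matrix.one_mulVec, ← Matrix.mulVec_mulVec, Pi.smul_apply, Pi.add_apply, Pi.sub_apply,
    smul_eq_mul, matC, Matrix.mulVec_diagonal, hS]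
  split_ifs <;> ring

theorem iterationMatrix_mulVec_blank (γ : ℝ) {given : Grid n} (v : Fin 5 × Pos n → ℝ)
    {p : Pos n} (hp : given p.1 p.2.1 = none) :
    (iterationMatrix γ given).mulVec v (4, p) =
      (1 / (1 + γ)) * (γ * ((1 / 5) * ∑ j, v (j, p)) + v (4, p)) := by
  rw [iterationMatrix_mulVec_apply, if_pos ⟨rfl, hp⟩]

theorem iterationMatrix_mulVec_of_ne (γ : ℝ) (given : Grid n) (v : Fin 5 × Pos n → ℝ)
    {i : Fin 5} {p : Pos n} (hp : i ≠ 4 ∨ given p.1 p.2.1 ≠ none) :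
    (iterationMatrix γ given).mulVec v (i, p) =
      (1 / (1 + γ)) * (γ * (v (i, p) - (1 / 5) * ∑ j, v (j, p))) := by
  rw [iterationMatrix_mulVec_apply, if_neg (by tauto)]

end Matrix

/-! ### Modes of the iteration matrix -/

section Rate

variable {γ : ℝ}

theorem sqrt_discriminant_sq (hγ0 : 0 < γ) (hγ : γ < 1 / 4) :
    Real.sqrt (25 - 16 * γ ^ 2) ^ 2 = 25 - 16 * γ ^ 2 :=
  Real.sq_sqrt (by nlinarith)

theorem sqrt_discriminant_mem (hγ0 : 0 < γ) (hγ : γ < 1 / 4) :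
    4 < Real.sqrt (25 - 16 * γ ^ 2) ∧ Real.sqrt (25 - 16 * γ ^ 2) < 5 :=
  ⟨Real.lt_sqrt_of_sq_lt (by nlinarith), (Real.sqrt_lt' (by norm_num)).2 (by nlinarith)⟩

theorem rate_pos (hγ0 : 0 < γ) : 0 < rate γ := by
  unfold rate; positivity

theorem rate_lt_one (hγ0 : 0 < γ) (hγ : γ < 1 / 4) : rate γ < 1 := by
  have := (sqrt_discriminant_mem hγ0 hγ).2
  rw [rate, div_lt_one (by positivity)]
  linarith

theorem div_one_add_le_rate (hγ0 : 0 < γ) (hγ : γ < 1 / 4) : γ / (1 + γ) ≤ rate γ := by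
  have := (sqrt_discriminant_mem hγ0 hγ).1
  rw [rate, div_le_div_iff₀ (by positivity) (by positivity)]
  nlinarith

/-- The filter `⊤` makes one constant valid for every `k`, as needed for geometric Cauchy bounds. -/
theorem isBigO_pow_of_succ {f : ℕ → ℝ} {c r : ℝ} (hc : |c| ≤ r) (hf : ∀ k, f (k + 1) = c * f k) :
    f =O[⊤] fun k => r ^ k := by
  refine Asymptotics.isBigO_top.2 ⟨|f 0|, fun k => ?_⟩
  have hr : 0 ≤ r := (abs_nonneg c).trans hc
  rw [Real.norm_eq_abs, Real.norm_of_nonneg (by positivity)]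
  induction k with
  | zero => simp
  | succ k ih =>
    rw [hf, abs_mul, pow_succ']
    calc |c| * |f k| ≤ r * (|f 0| * r ^ k) := by gcongr
      _ = _ := by ring

/-- Every orbit of the iteration matrix decays at the rate `rate γ`. -/
theorem isBigO_orbit {n : ℕ} (hγ0 : 0 < γ) (hγ : γ < 1 / 4) {given : Grid n}
    {v : ℕ → Fin 5 × Pos n → ℝ} (hv : ∀ k, v (k + 1) = (iterationMatrix γ given).mulVec (v k))
    (q : Fin 5 × Pos n) : (fun k => v k q) =O[⊤] fun k => rate γ ^ k := by
  obtain ⟨i, p⟩ := q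
  have hρ : |γ / (1 + γ)| ≤ rate γ := by
    rw [abs_of_pos (by positivity)]; exact div_one_add_le_rate hγ0 hγ
  have hne : ∀ k j, (j ≠ 4 ∨ given p.1 p.2.1 ≠ none) → v (k + 1) (j, p) =
      (1 / (1 + γ)) * (γ * (v k (j, p) - (1 / 5) * ∑ j, v k (j, p))) := fun k j hj => by
    rw [hv k, iterationMatrix_mulVec_of_ne γ given _ hj]
  by_cases hp : given p.1 p.2.1 = none
  · set r := Real.sqrt (25 - 16 * γ ^ 2) with hr
    have hr2 : r ^ 2 = 25 - 16 * γ ^ 2 := sqrt_discriminant_sq hγ0 hγ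
    obtain ⟨hr4, hr5⟩ : 4 < r ∧ r < 5 := sqrt_discriminant_mem hγ0 hγ
    -- Over a blank cell, the sum `w` of the four discrete components and the fifth component form a
    -- closed 2 × 2 system; deviations from `w / 4` contract by `γ / (1 + γ)`.
    set w : ℕ → ℝ := fun k => v k (0, p) + v k (1, p) + v k (2, p) + v k (3, p) with hw
    have hsum : ∀ k, ∑ j, v k (j, p) = w k + v k (4, p) := fun k => by
      rw [Fin.sum_univ_five]
    have hw1 : ∀ k, w (k + 1) =
        (1 / (1 + γ)) * (γ * (w k - (4 / 5) * (w k + v k (4, p)))) := fun k => by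
      rw [← hsum k]
      simp only [hw]
      rw [hne k 0 (Or.inl (by decide)), hne k 1 (Or.inl (by decide)),
        hne k 2 (Or.inl (by decide)), hne k 3 (Or.inl (by decide))]
      ring
    have ht1 : ∀ k, v (k + 1) (4, p) =
        (1 / (1 + γ)) * (γ * ((1 / 5) * (w k + v k (4, p))) + v k (4, p)) := fun k => by
      rw [hv k, iterationMatrix_mulVec_blank γ _ hp, hsum]
    -- The coefficients `(γ, (5 + s) / 2)` form a left eigenvector of that system; `s = ± r` gives
    -- both eigenvalues.
    have hmode : ∀ s : ℝ, s ^ 2 = 25 - 16 * γ ^ 2 → |(2 * γ + 5 + s) / (10 * (1 + γ))| ≤ rate γ →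
        (fun k => γ * w k + ((5 + s) / 2) * v k (4, p)) =O[⊤] fun k => rate γ ^ k := by
      intro s hs hle
      refine isBigO_pow_of_succ hle fun k => ?_
      rw [hw1, ht1]
      field_simp
      linear_combination (-5 * v k (4, p)) * hs
    have h1 := hmode r hr2 (by rw [abs_of_pos (by positivity), rate])
    have h2 := hmode (-r) (by rw [neg_sq, hr2]) (by
      rw [abs_of_pos (div_pos (by linarith) (by positivity)), rate]
      gcongr
      linarith)
    have ht : (fun k => v k (4, p)) =O[⊤] fun k => rate γ ^ k := by
      refine ((h1.sub h2).const_mul_left (1 / r)).congr_left fun k => ?_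
      field_simp
      ring
    have hwO : w =O[⊤] fun k => rate γ ^ k := by
      refine ((h1.sub (ht.const_mul_left ((5 + r) / 2))).const_mul_left (1 / γ)).congr_left
        fun k => ?_
      field_simp
      ring
    by_cases hi : i = 4
    · rw [hi]; exact ht
    · have hy : (fun k => v k (i, p) - w k / 4) =O[⊤] fun k => rate γ ^ k := by
        refine isBigO_pow_of_succ hρ fun k => ?_
        rw [hne k i (Or.inl hi), hw1, hsum]
        field_simp
        ring
      refine (hy.add (hwO.const_mul_left (1 / 4))).congr_left fun k => ?_
      ring
  -- Over a given cell the block is `γ / (1 + γ)` times subtraction of the mean.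
  · have hs : (fun k => ∑ j, v k (j, p)) =O[⊤] fun k => rate γ ^ k := by
      refine isBigO_pow_of_succ (c := 0) (by simpa using (rate_pos hγ0).le) fun k => ?_
      simp only [fun j => hne k j (Or.inr hp), ← Finset.mul_sum, Finset.sum_sub_distrib]
      simp
    have hy : (fun k => v k (i, p) - (1 / 5) * ∑ j, v k (j, p)) =O[⊤] fun k => rate γ ^ k := by
      refine isBigO_pow_of_succ hρ fun k => ?_
      simp only [fun j => hne k j (Or.inr hp), ← Finset.mul_sum, Finset.sum_sub_distrib]
      simp
      ring
    refine (hy.add (hs.const_mul_left (1 / 5))).congr_left fun k => ?_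
    ring

end Rate

/-! ### Semi-simplicity of the rate -/

section Semisimple

variable {n : ℕ} {γ : ℝ}

theorem hasEigenvalue_rate (hγ0 : 0 < γ) (hγ : γ < 1 / 4) {given : Grid n}
    {i j : Fin (n ^ 2)} (hij : given i j = none) :
    Module.End.HasEigenvalue (Matrix.toLin' (iterationMatrix γ given)) (rate γ) := by
  set r := Real.sqrt (25 - 16 * γ ^ 2) with hr
  have hr2 : r ^ 2 = 25 - 16 * γ ^ 2 := sqrt_discriminant_sq hγ0 hγ
  -- A right eigenvector of the 2 × 2 system, spread evenly over the discrete components; the digit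
  -- `i` is an arbitrary choice.
  let v : Fin 5 × Pos n → ℝ := fun q =>
    if q.2 = (i, j, i) then (if q.1 = 4 then γ else (r - 5) / 8) else 0
  have hsum : ∑ l, v (l, (i, j, i)) = (r - 5) / 2 + γ := by
    simp [v, Fin.sum_univ_five, show (0 : Fin 5) ≠ 4 by decide, show (1 : Fin 5) ≠ 4 by decide,
      show (2 : Fin 5) ≠ 4 by decide, show (3 : Fin 5) ≠ 4 by decide]
    ring
  refine Module.End.hasEigenvalue_of_hasEigenvector (x := v)
    (Module.End.hasEigenvector_iff.2 ⟨Module.End.mem_eigenspace_iff.2 ?_, fun h => ?_⟩)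
  · ext ⟨l, p⟩
    rw [Matrix.toLin'_apply, iterationMatrix_mulVec_apply, Pi.smul_apply, smul_eq_mul, rate, ← hr]
    by_cases hp : p = (i, j, i)
    · subst hp
      rw [hsum]
      by_cases hl : l = 4
      · simp only [hl, hij, v, and_self, if_true]
        field_simp
        ring
      · simp only [hl, v, false_and, if_true, if_false]
        field_simp
        linear_combination (-10) * hr2
    · simp [v, hp]
  · have := congrFun h (4, (i, j, i))
    simp [v] at this
    exact hγ0.ne' this

/-- With `y = (M - η) v` and `M y = η y`, the orbit of `v` is `η^k (v + (k/η) y)`; the bound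
`O(η^k)` forces `y = 0`. -/
theorem sub_rate_mulVec_eq_zero (hγ0 : 0 < γ) (hγ : γ < 1 / 4) {given : Grid n}
    {v : Fin 5 × Pos n → ℝ}
    (hv : (iterationMatrix γ given - rate γ • 1).mulVec
      ((iterationMatrix γ given - rate γ • 1).mulVec v) = 0) :
    (iterationMatrix γ given - rate γ • 1).mulVec v = 0 := by
  have hη := rate_pos hγ0
  obtain ⟨y, hy⟩ : ∃ y, (iterationMatrix γ given - rate γ • 1).mulVec v = y := ⟨_, rfl⟩
  rw [hy] at hv ⊢
  have hMv : (iterationMatrix γ given).mulVec v = y + rate γ • v := by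
    rw [← hy, Matrix.sub_mulVec, Matrix.smul_mulVec, Matrix.one_mulVec, sub_add_cancel]
  have hMy : (iterationMatrix γ given).mulVec y = rate γ • y := by
    rwa [Matrix.sub_mulVec, Matrix.smul_mulVec, Matrix.one_mulVec, sub_eq_zero] at hv
  have horbit := isBigO_orbit hγ0 hγ (given := given)
    (v := fun k => rate γ ^ k • (v + ((k : ℝ) / rate γ) • y)) (fun k => by
      rw [Matrix.mulVec_smul, Matrix.mulVec_add, Matrix.mulVec_smul, hMv, hMy]
      ext q
      simp only [Pi.smul_apply, Pi.add_apply, smul_eq_mul]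
      push_cast
      field_simp
      ring)
  ext q
  obtain ⟨c, hc⟩ := Asymptotics.isBigO_top.1 (horbit q)
  by_contra hne
  have hpos : 0 < |y q| := abs_pos.2 hne
  obtain ⟨k, hk⟩ := exists_nat_gt ((c + |v q|) * rate γ / |y q|)
  have h := hc k
  simp only [Pi.smul_apply, Pi.add_apply, smul_eq_mul, norm_mul] at h
  rw [mul_comm, mul_le_mul_iff_left₀ (norm_pos_iff.2 (by positivity)), Real.norm_eq_abs] at h
  have h1 : (k : ℝ) / rate γ * |y q| ≤ c + |v q| := by
    calc (k : ℝ) / rate γ * |y q| = |(v q + k / rate γ * y q) - v q| := by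
          rw [add_sub_cancel_left, abs_mul,
            abs_of_nonneg (a := (k : ℝ) / rate γ) (by positivity)]
      _ ≤ |v q + k / rate γ * y q| + |v q| := abs_sub _ _
      _ ≤ _ := by gcongr
  rw [div_lt_iff₀ hpos] at hk
  rw [div_mul_eq_mul_div, div_le_iff₀ hη] at h1
  linarith

theorem rank_eq_rank_sq_of_ker {ι : Type*} [Fintype ι] [DecidableEq ι] {N : Matrix ι ι ℝ}
    (hN : ∀ v, N.mulVec (N.mulVec v) = 0 → N.mulVec v = 0) : N.rank = (N ^ 2).rank := by
  have hker : LinearMap.ker N.mulVecLin = LinearMap.ker (N ^ 2).mulVecLin := by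
    ext v
    simp only [LinearMap.mem_ker, Matrix.mulVecLin_apply, sq, ← Matrix.mulVec_mulVec]
    exact ⟨fun h => by rw [h, Matrix.mulVec_zero], hN v⟩
  have h1 := LinearMap.finrank_range_add_finrank_ker N.mulVecLin
  have h2 := LinearMap.finrank_range_add_finrank_ker (N ^ 2).mulVecLin
  rw [hker] at h1
  unfold Matrix.rank
  omega

theorem isSemisimpleEigenvalue_rate (hγ0 : 0 < γ) (hγ : γ < 1 / 4) {given : Grid n}
    (h : ∃ i j, given i j = none) :
    IsSemisimpleEigenvalue (iterationMatrix γ given) (rate γ) := by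
  obtain ⟨i, j, hij⟩ := h
  exact ⟨hasEigenvalue_rate hγ0 hγ hij,
    rank_eq_rank_sq_of_ker fun _ => sub_rate_mulVec_eq_zero hγ0 hγ⟩

end Semisimple


open Filter Topology

/-! ### The diagonal subspace -/

section Diagonal

variable (m : ℕ) (E : Type*) [NormedAddCommGroup E] [InnerProductSpace ℝ E]

/-- The diagonal of `E^m` as a linear subspace. -/
def diagonalSubmodule : Submodule ℝ (PiLp 2 fun _ : Fin m => E) where
  carrier := diagonalSet m E
  add_mem' hx hy i j := by simp [hx i j, hy i j]
  zero_mem' i j := by simp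
  smul_mem' c x hx i j := by simp [hx i j]

variable {m E}

theorem starProjection_diagonal_apply [(diagonalSubmodule m E).HasOrthogonalProjection]
    (z : PiLp 2 fun _ : Fin m => E) (i : Fin m) :
    (diagonalSubmodule m E).starProjection z i = (1 / (m : ℝ)) • ∑ j, z j := by
  have hm : (m : ℝ) ≠ 0 := Nat.cast_ne_zero.2 i.pos.ne'
  rw [Submodule.eq_starProjection_of_mem_of_inner_eq_zero
    (v := WithLp.toLp 2 fun _ => (1 / (m : ℝ)) • ∑ j, z j)]
  · exact fun _ _ => rfl
  · intro w hw
    have hw' : ∀ j, w j = w i := fun j => hw j i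
    rw [PiLp.inner_apply]
    simp only [hw', ← sum_inner, PiLp.sub_apply, Finset.sum_sub_distrib, Finset.sum_const,
      Finset.card_univ, Fintype.card_fin, ← Nat.cast_smul_eq_nsmul ℝ, smul_smul]
    rw [mul_one_div_cancel hm, one_smul, sub_self, inner_zero_left]

end Diagonal

/-! ### Discreteness and coordinates of the Sudoku sets -/

section Coordinates

variable {n : ℕ}

theorem IsUnitOn.eq_zero_or_one {x : Cube n} {L : Set (Pos n)} (h : IsUnitOn x L) {p : Pos n}
    (hp : p ∈ L) : x p = 0 ∨ x p = 1 := by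
  obtain ⟨q, -, hq, h0⟩ := h
  by_cases hpq : p = q
  · exact Or.inr (hpq ▸ hq)
  · exact Or.inl (h0 p hp hpq)

theorem sudokuSets_eq_zero_or_one {given : Grid n} {i : Fin 5} (hi : i ≠ 4) {x : Cube n}
    (hx : x ∈ sudokuSets given i) (p : Pos n) : x p = 0 ∨ x p = 1 := by
  fin_cases i
  · exact IsUnitOn.eq_zero_or_one (hx p.2.1 p.2.2) ⟨rfl, rfl⟩
  · exact IsUnitOn.eq_zero_or_one (hx p.1 p.2.2) ⟨rfl, rfl⟩
  · exact IsUnitOn.eq_zero_or_one (hx p.1 p.2.1) ⟨rfl, rfl⟩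
  · have hlt : ∀ a : Fin (n ^ 2), (a : ℕ) / n < n := fun a =>
      Nat.div_lt_of_lt_mul (by rw [← sq]; exact a.2)
    exact IsUnitOn.eq_zero_or_one (hx ⟨_, hlt p.1⟩ ⟨_, hlt p.2.1⟩ p.2.2) ⟨rfl, rfl, rfl⟩
  · exact absurd rfl hi

theorem eq_of_norm_sub_lt_one {given : Grid n} {i : Fin 5} (hi : i ≠ 4) {x y : Cube n}
    (hx : x ∈ sudokuSets given i) (hy : y ∈ sudokuSets given i) (h : ‖x - y‖ < 1) : x = y := by
  ext p
  have hp : |x p - y p| < 1 := (PiLp.norm_apply_le (x - y) p).trans_lt h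
  rcases sudokuSets_eq_zero_or_one hi hx p with h1 | h1 <;>
    rcases sudokuSets_eq_zero_or_one hi hy p with h2 | h2 <;> rw [h1, h2] at hp ⊢ <;>
    norm_num at hp

theorem C₅_apply_eq {given : Grid n} {x y : Cube n} (hx : x ∈ C₅ given) (hy : y ∈ C₅ given)
    {p : Pos n} (hp : given p.1 p.2.1 ≠ none) : x p = y p := by
  obtain ⟨d, hd⟩ := Option.ne_none_iff_exists'.1 hp
  exact (hx p.1 p.2.1 d hd p.2.2).trans (hy p.1 p.2.1 d hd p.2.2).symm

theorem proj_C₅_apply_blank {given : Grid n} {u w : Cube n} (hu : u ∈ proj (C₅ given) w)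
    {p : Pos n} (hp : given p.1 p.2.1 = none) : u p = w p := by
  rw [mem_proj_iff] at hu
  -- Resetting the free coordinate `p` to its value in `w` stays feasible and lowers the squared
  -- distance by `(w p - u p)²`.
  have h := hu.2 (u + EuclideanSpace.single p (w p - u p)) fun i j d hd k => by
    have hne : (i, j, k) ≠ p := by rintro rfl; simp [hd] at hp
    simpa [hne] using hu.1 i j d hd k
  rw [← sub_sub, ← sq_le_sq₀ (norm_nonneg _) (norm_nonneg _), norm_sub_sq_real (w - u),
    EuclideanSpace.inner_single_right, PiLp.norm_single] at h
  simp only [PiLp.sub_apply, conj_trivial, Real.norm_eq_abs, sq_abs] at h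
  nlinarith [sq_nonneg (w p - u p)]

theorem norm_le_sum_norm {ι : Type*} [Fintype ι] {β : ι → Type*} [∀ i, SeminormedAddCommGroup (β i)]
    (x : PiLp 2 β) : ‖x‖ ≤ ∑ i, ‖x i‖ := by
  have h0 : 0 ≤ ∑ i, ‖x i‖ := Finset.sum_nonneg fun i _ => norm_nonneg _
  rw [← sq_le_sq₀ (norm_nonneg _) h0, PiLp.norm_sq_eq_of_L2]
  exact Finset.sum_sq_le_sq_sum_of_nonneg fun i _ => norm_nonneg _

theorem norm_le_sum_abs_flat (z : Cube5 n) : ‖z‖ ≤ ∑ q, |flat z q| := by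
  rw [Fintype.sum_prod_type]
  exact (norm_le_sum_norm z).trans (Finset.sum_le_sum fun i _ => norm_le_sum_norm (z i))

theorem continuous_flat : Continuous (flat : Cube5 n → Fin 5 × Pos n → ℝ) := by
  unfold flat
  fun_prop

end Coordinates

/-! ### Finite identification and linear convergence -/

section Iteration

variable {n : ℕ} {given : Grid n} {γ : ℝ} {u x z : ℕ → Cube5 n}

theorem IsDDRSequence.shadow_eq (h : IsDDRSequence γ (sudokuSets given) u x z) (k : ℕ) :
    x (k + 1) =
      (1 / (1 + γ)) • (z k + γ • (diagonalSubmodule 5 (Cube n)).starProjection (z k)) := by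
  refine PiLp.ext fun i => ?_
  rw [(h k i).1, PiLp.smul_apply, PiLp.add_apply, PiLp.smul_apply, starProjection_diagonal_apply]

theorem IsDDRSequence.step_eq (h : IsDDRSequence γ (sudokuSets given) u x z) (k : ℕ) :
    z (k + 1) = z k + u (k + 1) - x (k + 1) :=
  PiLp.ext fun i => (h k i).2.2

theorem eq_shadow_add {H : Type*} [NormedAddCommGroup H] [InnerProductSpace ℝ H]
    (K : Submodule ℝ H) [K.HasOrthogonalProjection] (hγ : 1 + γ ≠ 0) {x z : H}
    (h : x = (1 / (1 + γ)) • (z + γ • K.starProjection z)) :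
    z = x + γ • Kᗮ.starProjection x := by
  have hP : K.starProjection x = K.starProjection z := by
    rw [h, map_smul, map_add, map_smul,
      Submodule.starProjection_eq_self_iff.2 (K.starProjection_apply_mem z)]
    match_scalars
    field_simp
  rw [Submodule.starProjection_orthogonal_val, hP, h]
  match_scalars <;> field_simp
  ring

theorem IsDDRSequence.tendsto_sub_zero (h : IsDDRSequence γ (sudokuSets given) u x z)
    (hγ0 : 0 < γ) (hγ : γ ≤ 1 / 2) :
    Tendsto (fun k => z (k + 1) - z k) atTop (𝓝 0) ∧
      Tendsto (fun k => u (k + 1 + 1) - u (k + 1)) atTop (𝓝 0) := by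
  set Q := (diagonalSubmodule 5 (Cube n))ᗮ.starProjection with hQ
  have hz : ∀ k, z k = x (k + 1) + γ • Q (x (k + 1)) := fun k =>
    eq_shadow_add _ (by positivity) (h.shadow_eq k)
  have hx : Tendsto (fun k => x (k + 1 + 1) - x (k + 1)) atTop (𝓝 0) :=
    tendsto_shadow_sub_zero (diagonalSubmodule 5 (Cube n)) (C := prodSet (sudokuSets given))
      -- The shift pairs `z k` with the shadow point computed from it.
      hγ0 hγ (u := fun k => u (k + 1)) (x := fun k => x (k + 1)) hz
      (fun k => mem_proj_prodSet fun i => (h k i).2.1) h.step_eq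
  have hzd : Tendsto (fun k => z (k + 1) - z k) atTop (𝓝 0) := by
    have := hx.add (((Q.continuous.tendsto 0).comp hx).const_smul γ)
    rw [map_zero, smul_zero, add_zero] at this
    refine this.congr fun k => ?_
    rw [hz (k + 1), hz k, Function.comp_apply, map_sub, smul_sub]
    abel
  refine ⟨hzd, ?_⟩
  have := (hx.add (hzd.comp (tendsto_add_atTop_nat 1))).sub hzd
  rw [add_zero, sub_zero] at this
  refine this.congr fun k => ?_
  rw [Function.comp_apply, h.step_eq (k + 1), h.step_eq k]
  abel

theorem IsDDRSequence.exists_forall_eq (h : IsDDRSequence γ (sudokuSets given) u x z)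
    (hγ0 : 0 < γ) (hγ : γ ≤ 1 / 2) :
    ∃ K, ∀ k ≥ K, ∀ i : Fin 5, i ≠ 4 → u (k + 1) i = u (K + 1) i := by
  obtain ⟨K, hK⟩ := eventually_atTop.1 <|
    (h.tendsto_sub_zero hγ0 hγ).2.norm.eventually_lt_const (by simp : ‖(0 : Cube5 n)‖ < 1)
  refine ⟨K, fun k hk i hi => ?_⟩
  induction k, hk using Nat.le_induction with
  | base => rfl
  | succ k hk ih =>
    rw [← ih]
    exact eq_of_norm_sub_lt_one hi (h (k + 1) i).2.1.1 (h k i).2.1.1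
      ((PiLp.norm_apply_le (u (k + 1 + 1) - u (k + 1)) i).trans_lt (hK k hk))

/-- Once the discrete components of `u` agree, differences of iterates are transported by the
iteration matrix. -/
theorem IsDDRSequence.flat_sub_eq (h : IsDDRSequence γ (sudokuSets given) u x z) (hγ : 1 + γ ≠ 0)
    {j k : ℕ} (hjk : ∀ i : Fin 5, i ≠ 4 → u (k + 1) i = u (j + 1) i) :
    flat (z (k + 1) - z (j + 1)) = (iterationMatrix γ given).mulVec (flat (z k - z j)) := by
  ext ⟨i, p⟩
  have hx : ∀ l, x (l + 1) i p =
      (1 / (1 + γ)) * (z l i p + γ * ((1 / 5) * ∑ j, z l j p)) := fun l => by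
    rw [(h l i).1]; simp [mul_add]
  have hz : ∀ l, z (l + 1) i p = z l i p + u (l + 1) i p - x (l + 1) i p := fun l => by
    rw [(h l i).2.2]; simp
  rw [iterationMatrix_mulVec_apply]
  simp only [flat, PiLp.sub_apply, Finset.sum_sub_distrib, hz]
  split_ifs with hp
  · obtain ⟨rfl, hp⟩ := hp
    have hu : ∀ l, u (l + 1) 4 p = 2 * x (l + 1) 4 p - z l 4 p := fun l => by
      simpa using proj_C₅_apply_blank (h l 4).2.1 hp
    rw [hu, hu, hx, hx]
    ring
  · have hu : u (k + 1) i p = u (j + 1) i p := by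
      by_cases hi : i = 4
      · subst hi
        exact C₅_apply_eq (h k 4).2.1.1 (h j 4).2.1.1 fun hb => hp ⟨rfl, hb⟩
      · rw [hjk i hi]
    rw [hu, hx, hx]
    field_simp
    ring

theorem IsDDRSequence.exists_tendsto (h : IsDDRSequence γ (sudokuSets given) u x z)
    (hγ0 : 0 < γ) (hγ : γ < 1 / 4) :
    ∃ zs : Cube5 n, Tendsto z atTop (𝓝 zs) ∧
      ((fun k => ‖z k - zs‖) =O[atTop] fun k : ℕ => rate γ ^ k) ∧
      ∀ᶠ k in atTop, flat (z (k + 1) - zs) =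
        (iterationMatrix γ given).mulVec (flat (z k - zs)) := by
  have hη := rate_pos hγ0
  have hη1 := rate_lt_one hγ0 hγ
  obtain ⟨K, hK⟩ := h.exists_forall_eq hγ0 (by linarith)
  have hM : ∀ k ≥ K, ∀ j ≥ K, flat (z (k + 1) - z (j + 1)) =
      (iterationMatrix γ given).mulVec (flat (z k - z j)) := fun k hk j hj =>
    h.flat_sub_eq (by positivity) fun i hi => (hK k hk i hi).trans (hK j hj i hi).symm
  have horbit := isBigO_orbit hγ0 hγ (given := given)
    (v := fun k => flat (z (k + K) - z (k + 1 + K))) fun k => by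
      have := hM (k + K) (Nat.le_add_left _ _) (k + 1 + K) (Nat.le_add_left _ _)
      rwa [Nat.add_right_comm k, Nat.add_right_comm (k + 1)] at this
  obtain ⟨c, hc⟩ := Asymptotics.isBigO_top.1
    (Asymptotics.IsBigO.fun_sum fun (q : Fin 5 × Pos n) (_ : q ∈ Finset.univ) =>
      (horbit q).abs_left)
  have hgeom : ∀ k, dist (z (k + K)) (z (k + 1 + K)) ≤ c * rate γ ^ k := fun k => by
    rw [dist_eq_norm]
    refine (norm_le_sum_abs_flat _).trans ?_
    have := hc k
    rw [Real.norm_of_nonneg (by positivity : 0 ≤ rate γ ^ k)] at this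
    exact (le_abs_self _).trans this
  obtain ⟨zs, hzs⟩ := cauchySeq_tendsto_of_complete
    (cauchySeq_of_le_geometric (rate γ) c hη1 (f := fun k => z (k + K)) hgeom)
  have hlim : Tendsto z atTop (𝓝 zs) := (tendsto_add_atTop_iff_nat K).1 hzs
  refine ⟨zs, hlim, ?_, ?_⟩
  -- Summing the geometric tail gives `c / (1 - η)`; the factor `η^K` undoes the shift by `K`.
  · refine Asymptotics.IsBigO.of_bound (c / (1 - rate γ) / rate γ ^ K) ?_
    filter_upwards [eventually_ge_atTop K] with k hk
    obtain ⟨l, rfl⟩ := Nat.exists_eq_add_of_le' hk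
    rw [norm_norm, Real.norm_of_nonneg (by positivity), ← dist_eq_norm]
    refine (dist_le_of_le_geometric_of_tendsto (rate γ) c hη1 hgeom hzs l).trans_eq ?_
    rw [pow_add]
    field_simp
  · filter_upwards [eventually_ge_atTop K] with k hk
    -- Letting `j → ∞` in `hM` turns the recursion for differences into one around the limit.
    have h1 : Tendsto (fun j => flat (z (k + 1) - z (j + 1))) atTop (𝓝 (flat (z (k + 1) - zs))) :=
      (continuous_flat.tendsto _).comp
        (tendsto_const_nhds.sub (hlim.comp (tendsto_add_atTop_nat 1)))
    have h2 : Tendsto (fun j => (iterationMatrix γ given).mulVec (flat (z k - z j))) atTop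
        (𝓝 ((iterationMatrix γ given).mulVec (flat (z k - zs)))) :=
      ((continuous_const.matrix_mulVec continuous_flat).tendsto _).comp
        (tendsto_const_nhds.sub hlim)
    refine tendsto_nhds_unique h1 (h2.congr' ?_)
    filter_upwards [eventually_ge_atTop K] with j hj
    exact (hM k hk j hj).symm

theorem isClosed_C₅ (given : Grid n) : IsClosed (C₅ given) := by
  simp only [C₅, Set.ofPred_forall]
  exact isClosed_iInter fun i => isClosed_iInter fun j => isClosed_iInter fun d =>
    isClosed_iInter fun _ => isClosed_iInter fun k =>
      isClosed_eq (by fun_prop) continuous_const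

/-- A projection of a relaxed reflection is a stationary point of the squared distance. -/
theorem isStationaryPoint_of_mem_proj {H : Type*} [NormedAddCommGroup H] [InnerProductSpace ℝ H]
    [CompleteSpace H] (K : Submodule ℝ H) [K.HasOrthogonalProjection] {C : Set H} (hγ : 0 < γ)
    {x z : H} (hz : z = x + γ • Kᗮ.starProjection x) (hx : x ∈ proj C ((2 : ℝ) • x - z)) :
    IsStationaryPoint (fun y => Metric.infDist y (K : Set H) ^ 2) C x := by
  -- Here `2x - z = x - γ Q x`, so scaling the proximal normal `-γ Q x` by `2/γ` gives minus the
  -- gradient `2 Q x`; constant sequences suffice.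
  refine ⟨hx.1, _, hasGradientAt_infDist_submodule_sq K x, fun _ => x,
    fun _ => -((2 : ℝ) • Kᗮ.starProjection x), fun _ => ⟨hx.1, 2 / γ, by positivity, _, hx, ?_⟩,
    tendsto_const_nhds, tendsto_const_nhds⟩
  rw [hz]
  match_scalars <;> field_simp
  ring

end Iteration

end DampedDR

/-! ### Assembly of the proposition -/

open DampedDR Filter Topology in
theorem proposition4p8 (n : ℕ) (given : DampedDR.Grid n)
    (hfeas : (DampedDR.prodSet (DampedDR.sudokuSets given) ∩
      DampedDR.diagonalSet 5 (DampedDR.Cube n)).Nonempty)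
    (γ : ℝ) (hγ0 : 0 < γ) (hγ1 : γ < Real.sqrt (3 / 2) - 1)
    (u x z : ℕ → DampedDR.Cube5 n)
    (hseq : DampedDR.IsDDRSequence γ (DampedDR.sudokuSets given) u x z) :
    (∃ xs zs : DampedDR.Cube5 n,
      Filter.Tendsto u Filter.atTop (nhds xs) ∧
      Filter.Tendsto x Filter.atTop (nhds xs) ∧
      Filter.Tendsto z Filter.atTop (nhds zs) ∧
      zs ∈ DampedDR.ddrOperator γ (DampedDR.prodSet (DampedDR.sudokuSets given))
        (DampedDR.diagonalSet 5 (DampedDR.Cube n)) zs ∧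
      xs ∈ DampedDR.relaxedProj (γ / (1 + γ)) (DampedDR.diagonalSet 5 (DampedDR.Cube n)) zs ∧
      DampedDR.IsStationaryPoint
        (fun y => Metric.infDist y (DampedDR.diagonalSet 5 (DampedDR.Cube n)) ^ 2)
        (DampedDR.prodSet (DampedDR.sudokuSets given)) xs ∧
      ((∀ i : Fin 5, i ≠ 4 → xs i - zs i ∈
          interior (DampedDR.limitingNormalCone (DampedDR.sudokuSets given i) (xs i))) →
        (∀ᶠ k in Filter.atTop, ∀ i : Fin 5, i ≠ 4 → u k i = xs i) ∧
        ((fun k => ‖z k - zs‖) =O[Filter.atTop] fun k : ℕ => DampedDR.rate γ ^ k) ∧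
        (∀ᶠ k in Filter.atTop, DampedDR.flat (z (k + 1) - zs) =
          Matrix.mulVec (DampedDR.iterationMatrix γ given) (DampedDR.flat (z k - zs))))) ∧
    ((∃ i j, given i j = none) →
      DampedDR.IsSemisimpleEigenvalue (DampedDR.iterationMatrix γ given) (DampedDR.rate γ)) := by
  have hγ : γ < 1 / 4 := by
    have : Real.sqrt (3 / 2) < 5 / 4 := (Real.sqrt_lt' (by norm_num)).2 (by norm_num)
    linarith
  refine ⟨?_, isSemisimpleEigenvalue_rate hγ0 hγ⟩
  obtain ⟨zs, hz, hO, hM⟩ := hseq.exists_tendsto hγ0 hγ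
  set S := diagonalSubmodule 5 (Cube n) with hS
  obtain ⟨xs, hxs⟩ : ∃ xs, xs = (1 / (1 + γ)) • (zs + γ • S.starProjection zs) := ⟨_, rfl⟩
  have hx1 : Tendsto (fun k => x (k + 1)) atTop (𝓝 xs) := by
    rw [hxs]
    refine Tendsto.congr (fun k => (hseq.shadow_eq k).symm) ?_
    exact (hz.add (((S.starProjection.continuous.tendsto zs).comp hz).const_smul γ)).const_smul _
  have hu1 : Tendsto (fun k => u (k + 1)) atTop (𝓝 xs) := by
    have := (hseq.tendsto_sub_zero hγ0 (by linarith)).1.add hx1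
    rw [zero_add] at this
    refine this.congr fun k => ?_
    rw [hseq.step_eq k]
    abel
  have happly : ∀ i : Fin 5, Continuous fun y : Cube5 n => y i := fun i => by fun_prop
  obtain ⟨K, hK⟩ := hseq.exists_forall_eq hγ0 (by linarith)
  have hconst : ∀ i : Fin 5, i ≠ 4 → xs i = u (K + 1) i := fun i hi =>
    tendsto_nhds_unique (((happly i).tendsto _).comp hu1) <|
      tendsto_const_nhds.congr' <| (eventually_ge_atTop K).mono fun k hk => (hK k hk i hi).symm
  -- Closedness is needed only for the affine set; the other components of the limit are attained.
  have hmem : ∀ i, xs i ∈ sudokuSets given i := fun i => by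
    by_cases hi : i = 4
    · subst hi
      exact (isClosed_C₅ given).mem_of_tendsto (((happly 4).tendsto _).comp hu1)
        (Eventually.of_forall fun k => (hseq k 4).2.1.1)
    · rw [hconst i hi]
      exact (hseq K i).2.1.1
  have hproj : xs ∈ proj (prodSet (sudokuSets given)) ((2 : ℝ) • xs - zs) :=
    mem_proj_prodSet fun i => mem_proj_of_tendsto (hmem i)
      (((happly i).tendsto _).comp ((hx1.const_smul (2 : ℝ)).sub hz))
      (((happly i).tendsto _).comp hu1) fun k => (hseq k i).2.1
  have hrelax : xs ∈ relaxedProj (γ / (1 + γ)) (diagonalSet 5 (Cube n)) zs := by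
    refine ⟨S.starProjection zs, starProjection_mem_proj S zs, ?_⟩
    rw [hxs]
    match_scalars <;> field_simp
    ring
  refine ⟨xs, zs, (tendsto_add_atTop_iff_nat 1).1 hu1, (tendsto_add_atTop_iff_nat 1).1 hx1, hz,
    ⟨xs, hrelax, xs, hproj, ?_⟩, hrelax,
    isStationaryPoint_of_mem_proj S hγ0 (eq_shadow_add S (by positivity) hxs) hproj,
    fun _ => ⟨?_, hO, hM⟩⟩
  · match_scalars <;> norm_num
  · filter_upwards [eventually_ge_atTop (K + 1)] with k hk i hi
    obtain ⟨l, rfl⟩ := Nat.exists_eq_add_of_le' hk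
    rw [hconst i hi, ← hK (l + K) (Nat.le_add_left _ _) i hi, add_assoc]
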